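/- Let $d\in\{2,3,4,\dots\}\cup\{\infty\}$. Let $\mathbf n=(n_j)_{j=1}^d$ be a $d$-tuple of distinct integers $n_j\ge 2$ and $\mathbf b=(b_j)_{j=1}^d$ a $d$-tuple of positive real numbers such that either $\sum_{j=1}^d b_j=1$, or $\sum_{j=1}^d b_j<1$ and the Dirichlet series $\sum_{j=1}^d b_jn_j^{-s}$ has abscissa of absolute convergence $0$. Assume that $\{\ln n_j: 1\le j\le d\}$ is linearly dependent over $\mathbb Q$. Let $\mathbb C^d$ be the Euclidean space (the space $\ell^2$ of square summable sequences if $d=\infty$), $\mathbb B_d$ its open unit ball, $H^2_d$ the Drury–Arveson space, i.e. the reproducing kernel Hilbert space on $\mathbb B_d$ with kernel $(\mathbf z,\mathbf w)\mapsto\frac1{1-\langle \mathbf z,\mathbf w\rangle}$, and $\mathcal M(H^2_d)$ the set of functions $g:\mathbb B_d\to\mathbb C$ with $gf\in H^2_d$ for all $f\in H^2_d$. Let $\mathbb H_0=\{s\in\mathbb C:\operatorname{Re}s>0\}$ and $f_{\mathbf b,\mathbf n}:\mathbb H_0\to\mathbb B_d$, $f_{\mathbf b,\mathbf n}(s)=(\sqrt{b_j}\,n_j^{-s})_{j=1}^d$.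 The multiplier variety associated with the kernel $K_{\mathbf b,\mathbf n}(s,u)=\frac{1}{1-\sum_{j=1}^d b_jn_j^{-s-\overline u}}=\frac1{1-\langle f_{\mathbf b,\mathbf n}(s),f_{\mathbf b,\mathbf n}(u)\rangle}$ on $\mathbb H_0$ is $$V=\{\mathbf z\in\mathbb B_d:\ g(\mathbf z)=0\text{ for all } g\in\mathcal M(H^2_d)\text{ with } g|_{f_{\mathbf b,\mathbf n}(\mathbb H_0)}\equiv 0\}.$$ Let $\mathcal J(\mathbf n)$ be the collection of all sets $J$ of indices such that $\{\ln n_j:j\in J\}$ is linearly dependent over $\mathbb Q$ while $\{\ln n_j:j\in I\}$ is linearly independent over $\mathbb Q$ for every proper subset $I$ of $J$. Then each $J\in\mathcal J(\mathbf n)$ is finite, and there are a unique (unordered) partition $\{J_1,J_2\}$ of $J$ into two non-empty parts and a unique tuple $(\beta_j)_{j\in J}$ of positive integers with $\gcd(\beta_j)_{j\in J}=1$ such that $$\prod_{i\in J_1}n_i^{\beta_i}=\prod_{i\in J_2}n_i^{\beta_i}.$$ Moreover, setting for each $J\in\mathcal J(\mathbf n)$ $$q_J(\mathbf z)=\prod_{i\in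 J_1}b_i^{\beta_i/2}\prod_{i\in J_2}z_i^{\beta_i}-\prod_{i\in J_2}b_i^{\beta_i/2}\prod_{i\in J_1}z_i^{\beta_i},\qquad \mathbf z=(z_i)_{i=1}^d\in\mathbb C^d$$ (which does not depend, up to sign, on which part is called $J_1$), and $Z(q_J)=\{\mathbf z\in\mathbb C^d: q_J(\mathbf z)=0\}$, one has $$V=\mathbb B_d\cap\bigcap_{J\in\mathcal J(\mathbf n)}Z(q_J).$$ -/

import Mathlib

noncomputable section

/-- The indices `1 ≤ j ≤ d` of a `d`-tuple, where `d` is a natural number or `∞`. -/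
abbrev TupleIdx (d : ℕ∞) : Type := {j : ℕ // 1 ≤ j ∧ (j : ℕ∞) ≤ d}

/-- The Hilbert space `ℂ^d`: all square summable families of complex numbers indexed by `ι`
(Euclidean space if `ι` is finite). -/
abbrev HilbertCd (ι : Type) : Type := lp (fun _ : ι => ℂ) 2

/-- The open unit ball `𝔹_d` of `ℂ^d`, as a set. -/
abbrev unitBall (ι : Type) : Set (HilbertCd ι) := Metric.ball 0 1

section DruryArveson

/-- The scalar kernel `(z, w) ↦ 1 / (1 - ⟨z, w⟩)` on the unit ball, where `⟨z, w⟩` is linear in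
`z` (Mathlib's `inner` is linear in its second argument). -/
def dAScalar (ι : Type) : Matrix (unitBall ι) (unitBall ι) ℂ :=
  fun z w => 1 / (1 - inner ℂ (w : HilbertCd ι) (z : HilbertCd ι))

/-- The Drury-Arveson kernel in the form which Mathlib's theory of reproducing kernel Hilbert
spaces expects: its entries are the operators of multiplication by a scalar on `ℂ`. -/
def dAKernel (ι : Type) : Matrix (unitBall ι) (unitBall ι) (ℂ →L[ℂ] ℂ) :=
  fun z w => dAScalar ι z w • ContinuousLinearMap.id ℂ ℂ

theorem norm_inner_ball_lt_one {ι : Type} (z w : unitBall ι) :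
    ‖inner ℂ (w : HilbertCd ι) (z : HilbertCd ι)‖ < 1 := by
  have hz : ‖(z : HilbertCd ι)‖ < 1 := mem_ball_zero_iff.mp z.2
  have hw : ‖(w : HilbertCd ι)‖ < 1 := mem_ball_zero_iff.mp w.2
  refine (norm_inner_le_norm _ _).trans_lt ?_
  nlinarith [norm_nonneg (z : HilbertCd ι), norm_nonneg (w : HilbertCd ι)]

open scoped ComplexOrder in
theorem posSemidef_inner_pow (ι : Type) (k : ℕ) :
    Matrix.PosSemidef (fun z w : unitBall ι =>
      inner ℂ (w : HilbertCd ι) (z : HilbertCd ι) ^ k : Matrix (unitBall ι) (unitBall ι) ℂ) := by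
  have h1 : Matrix.PosSemidef (fun z w : unitBall ι =>
      inner ℂ (w : HilbertCd ι) (z : HilbertCd ι) : Matrix (unitBall ι) (unitBall ι) ℂ) := by
    refine ⟨by ext z w; exact inner_conj_symm (w : HilbertCd ι) (z : HilbertCd ι), fun x => ?_⟩
    have : (x.sum fun i xi => x.sum fun j xj =>
        star xi * inner ℂ (j : HilbertCd ι) (i : HilbertCd ι) * xj) =
        inner ℂ (x.sum fun i xi => star xi • (i : HilbertCd ι))
          (x.sum fun i xi => star xi • (i : HilbertCd ι)) := by
      simp only [Finsupp.sum, sum_inner, inner_sum, inner_smul_left, inner_smul_right,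
        Finset.mul_sum]
      refine Finset.sum_congr rfl fun i _ => Finset.sum_congr rfl fun j _ => ?_
      simp
      ring
    rw [this, inner_self_eq_norm_sq_to_K]
    norm_cast
    exact Complex.zero_le_real.mpr (sq_nonneg _)
  induction k with
  | zero =>
    refine ⟨by ext z w; simp only [pow_zero]; exact star_one ℂ, fun x => ?_⟩
    have : (x.sum fun i xi => x.sum fun j xj => star xi * (1 : ℂ) * xj)
        = star (x.sum fun _ xi => xi) * (x.sum fun _ xj => xj) := by
      simp only [Finsupp.sum, star_sum, Finset.sum_mul_sum, mul_one]
    simp only [pow_zero]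
    rw [this]
    exact star_mul_self_nonneg _
  | succ k ih =>
    have := ih.hadamard h1
    convert! this using 1

open scoped ComplexOrder in
theorem posSemidef_dAScalar (ι : Type) : (dAScalar ι).PosSemidef := by
  refine ⟨by ext; simp [dAScalar, Matrix.conjTranspose_apply], fun x => ?_⟩
  have hs : HasSum (fun k : ℕ => x.sum fun i xi => x.sum fun j xj =>
      star xi * inner ℂ (j : HilbertCd ι) (i : HilbertCd ι) ^ k * xj)
      (x.sum fun i xi => x.sum fun j xj => star xi * dAScalar ι i j * xj) := by
    simp only [Finsupp.sum]
    refine hasSum_sum fun i _ => hasSum_sum fun j _ => ?_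
    refine (HasSum.mul_left _ ?_).mul_right _
    simpa [dAScalar] using hasSum_geometric_of_norm_lt_one (norm_inner_ball_lt_one i j)
  exact hs.nonneg fun k => (posSemidef_inner_pow ι k).2 x

open scoped ComplexOrder in
theorem posSemidef_dAKernel (ι : Type) : (dAKernel ι).PosSemidef := by
  have key : (dAKernel ι).IsHermitian ∧ ∀ vv : unitBall ι →₀ ℂ,
      0 ≤ RCLike.re (vv.sum fun x w => vv.sum fun x' w' => inner ℂ (dAKernel ι x' x w) w') := by
    refine ⟨?_, fun vv => ?_⟩
    · ext1 z w
      have h := congrFun₂ (posSemidef_dAScalar ι).1 z w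
      simp only [Matrix.conjTranspose_apply] at h
      simp only [Matrix.conjTranspose_apply, dAKernel, star_smul, h]
      simp [← ContinuousLinearMap.one_def]
    · have h := (posSemidef_dAScalar ι).2 vv
      have h2 : (vv.sum fun x w => vv.sum fun x' w' => inner ℂ (dAKernel ι x' x w) w') =
          vv.sum fun i xi => vv.sum fun j xj => star xi * dAScalar ι i j * xj := by
        simp only [Finsupp.sum]
        refine Finset.sum_congr rfl fun i _ => Finset.sum_congr rfl fun j _ => ?_
        have h := congrFun₂ (posSemidef_dAScalar ι).1 i j
        simp only [Matrix.conjTranspose_apply] at h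
        rw [← h]
        simp [dAKernel]
        ring
      rw [h2]
      exact (Complex.nonneg_iff.mp h).1
  exact ((RKHS.posSemidef_tfae (K := dAKernel ι)).out 0 2).mpr key

instance dAKernel_fact (ι : Type) : Fact (dAKernel ι).PosSemidef := ⟨posSemidef_dAKernel ι⟩

/-- The Drury-Arveson space `H²_d`: the reproducing kernel Hilbert space on the unit ball with
kernel `1 / (1 - ⟨z, w⟩)`. -/
abbrev DruryArveson (ι : Type) : Type := RKHS.OfKernel (dAKernel ι)

/-- `g` is a multiplier of the Drury-Arveson space, i.e. `g ∈ 𝓜(H²_d)`: multiplication by `g`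
maps the space, viewed as a space of functions on the ball, into itself. -/
def IsDAMultiplier {ι : Type} (g : unitBall ι → ℂ) : Prop :=
  ∀ f : DruryArveson ι, ∃ h : DruryArveson ι, ∀ z : unitBall ι, h z = g z * f z

end DruryArveson

section Dirichlet

/-- The coefficient function `m ↦ ∑_{j : n_j = m} b_j` of the Dirichlet series
`∑_j b_j n_j^{-s}`, for an injective family `n`. -/
def dirichletCoeff {ι : Type} (b : ι → ℝ) (n : ι → ℕ) : ℕ → ℂ :=
  Function.extend n (fun j => (b j : ℂ)) (fun _ => 0)

/-- Property (P): the `n_j` are distinct integers `≥ 2`, the `b_j` are positive, and either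
`∑ b_j = 1`, or `∑ b_j < 1` and the abscissa of absolute convergence of `∑ b_j n_j^{-s}`
is `0`. -/
structure PropertyP {ι : Type} (b : ι → ℝ) (n : ι → ℕ) : Prop where
  two_le : ∀ j, 2 ≤ n j
  injective : Function.Injective n
  pos : ∀ j, 0 < b j
  sum : HasSum b 1 ∨
    (Summable b ∧ ∑' j, b j < 1 ∧ LSeries.abscissaOfAbsConv (dirichletCoeff b n) = 0)

/-- The coordinates `√b_j n_j^{-s}` of the map `f_{b,n}`. -/
def dirichletCoord {ι : Type} (b : ι → ℝ) (n : ι → ℕ) (s : ℂ) (j : ι) : ℂ :=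
  (√(b j) : ℂ) * (n j : ℂ) ^ (-s)

variable {ι : Type} {b : ι → ℝ} {n : ι → ℕ}

theorem PropertyP.summable (h : PropertyP b n) : Summable b :=
  h.sum.elim HasSum.summable And.left

theorem PropertyP.tsum_le_one (h : PropertyP b n) : ∑' j, b j ≤ 1 :=
  h.sum.elim (fun H => H.tsum_eq.le) (fun H => H.2.1.le)

theorem PropertyP.norm_coord_sq_le (h : PropertyP b n) {s : ℂ} (hs : 0 < s.re) (j : ι) :
    ‖dirichletCoord b n s j‖ ^ 2 ≤ ((2 : ℝ) ^ (-s.re)) ^ 2 * b j := by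
  have hn : 0 < n j := by have := h.two_le j; omega
  have h2 : (2 : ℝ) ≤ n j := by exact_mod_cast h.two_le j
  have h3 : (n j : ℝ) ^ (-s.re) ≤ (2 : ℝ) ^ (-s.re) :=
    Real.rpow_le_rpow_of_nonpos (by norm_num) h2 (by linarith)
  have h4 : (0 : ℝ) ≤ (n j : ℝ) ^ (-s.re) := by positivity
  rw [dirichletCoord, norm_mul, Complex.norm_natCast_cpow_of_pos hn, mul_pow,
    Complex.norm_real, Real.norm_of_nonneg (Real.sqrt_nonneg _), Real.sq_sqrt (h.pos j).le,
    mul_comm, Complex.neg_re]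
  have := (h.pos j).le
  gcongr

theorem PropertyP.memℓp_coord (h : PropertyP b n) {s : ℂ} (hs : 0 < s.re) :
    Memℓp (dirichletCoord b n s) 2 := by
  refine memℓp_gen ?_
  simp only [ENNReal.toReal_ofNat, Real.rpow_ofNat]
  exact .of_nonneg_of_le (fun _ => by positivity) (h.norm_coord_sq_le hs)
    (h.summable.mul_left _)

theorem PropertyP.coord_mem_ball (h : PropertyP b n) {s : ℂ} (hs : 0 < s.re) :
    (⟨dirichletCoord b n s, h.memℓp_coord hs⟩ : HilbertCd ι) ∈ unitBall ι := by
  rw [mem_ball_zero_iff]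
  set v : HilbertCd ι := ⟨dirichletCoord b n s, h.memℓp_coord hs⟩ with hv
  have h1 := lp.hasSum_norm (p := 2) (by norm_num) v
  simp only [ENNReal.toReal_ofNat, Real.rpow_ofNat] at h1
  have h2 : ‖v‖ ^ 2 ≤ ((2 : ℝ) ^ (-s.re)) ^ 2 * ∑' j, b j :=
    hasSum_le (h.norm_coord_sq_le hs) h1 (h.summable.hasSum.mul_left _)
  have h3 : (2 : ℝ) ^ (-s.re) < 1 :=
    Real.rpow_lt_one_of_one_lt_of_neg (by norm_num) (by linarith)
  have h4 : (0 : ℝ) < (2 : ℝ) ^ (-s.re) := by positivity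
  have h5 := h.tsum_le_one
  nlinarith [norm_nonneg v]

/-- The map `f_{b,n} : ℍ₀ → 𝔹_d`, `s ↦ (√b_j n_j^{-s})_j`, on the right half-plane
`ℍ₀ = {s : Re s > 0}`. -/
def PropertyP.toBall (h : PropertyP b n) (s : {s : ℂ // 0 < s.re}) : unitBall ι :=
  ⟨⟨dirichletCoord b n s, h.memℓp_coord s.2⟩, h.coord_mem_ball s.2⟩

/-- The multiplier variety associated with the kernel
`K_{b,n}(s, u) = 1 / (1 - ⟨f_{b,n}(s), f_{b,n}(u)⟩)`: the points of the ball at which every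
multiplier of the Drury-Arveson space that vanishes on `f_{b,n}(ℍ₀)` vanishes. -/
def multiplierVariety (h : PropertyP b n) : Set (HilbertCd ι) :=
  {z | ∃ hz : z ∈ unitBall ι, ∀ g : unitBall ι → ℂ, IsDAMultiplier g →
    (∀ s, g (h.toBall s) = 0) → g ⟨z, hz⟩ = 0}

end Dirichlet

section Binomials

/-- The collection `𝒥(n)` of all sets `J` of indices such that `{ln n_j : j ∈ J}` is linearly
dependent over `ℚ`, but `{ln n_j : j ∈ I}` is linearly independent for every proper subset `I`
of `J`. -/
def minimalDependentSets {ι : Type} (n : ι → ℕ) : Set (Set ι) :=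
  {J | ¬ LinearIndepOn ℚ (fun j => Real.log (n j)) J ∧
    ∀ I, I ⊂ J → LinearIndepOn ℚ (fun j => Real.log (n j)) I}

/-- `{J₁, J₂}` is a partition of `J` and `(β_j)_{j ∈ J}` is a tuple of positive integers with
greatest common divisor `1` such that `∏_{i ∈ J₁} n_i^{β_i} = ∏_{i ∈ J₂} n_i^{β_i}`.
The tuple `β` is extended by `0` outside `J`. -/
structure IsRepresentation {ι : Type} (n : ι → ℕ) (J : Set ι) (J₁ J₂ : Finset ι)
    (β : ι →₀ ℕ) : Prop where
  nonempty_left : J₁.Nonempty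
  nonempty_right : J₂.Nonempty
  disjoint : Disjoint J₁ J₂
  union_eq : (J₁ : Set ι) ∪ (J₂ : Set ι) = J
  support_eq : (β.support : Set ι) = J
  gcd_eq_one : β.support.gcd β = 1
  prod_eq : ∏ i ∈ J₁, n i ^ β i = ∏ i ∈ J₂, n i ^ β i

/-- The binomial
`∏_{i ∈ J₁} b_i^{β_i/2} ∏_{i ∈ J₂} z_i^{β_i} - ∏_{i ∈ J₂} b_i^{β_i/2} ∏_{i ∈ J₁} z_i^{β_i}`. -/
def binomialPoly {ι : Type} (b : ι → ℝ) (J₁ J₂ : Finset ι) (β : ι →₀ ℕ) : MvPolynomial ι ℂ :=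
  MvPolynomial.C ((∏ i ∈ J₁, b i ^ ((β i : ℝ) / 2) : ℝ) : ℂ) *
      ∏ i ∈ J₂, MvPolynomial.X i ^ β i -
    MvPolynomial.C ((∏ i ∈ J₂, b i ^ ((β i : ℝ) / 2) : ℝ) : ℂ) *
      ∏ i ∈ J₁, MvPolynomial.X i ^ β i

/-- The zero set in `ℂ^d` of a polynomial. -/
def polyZeroSet {ι : Type} (q : MvPolynomial ι ℂ) : Set (HilbertCd ι) :=
  {z | MvPolynomial.eval (fun j => z j) q = 0}

end Binomials

end

noncomputable section

/-! Put `w j = z j / √(b j)`. On the range of `f_{b,n}` one has `w j = n j ^ (-s)`, so every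
multiplicative relation between the `n j` passes to the `w j`; after rescaling, `q_J` expresses the
relation that belongs to `J`. As polynomials are multipliers, `V` lies in every `Z(q_J)`.

For the converse, a multiplier `g` lies in the Drury–Arveson space, which embeds isometrically into
the full Fock space. Hence `g` is a power series `∑ c_l z_l` over words `l`, with square summable
coefficients. On the range of `f_{b,n}` it becomes a Dirichlet series in the products of `n` along
the words, and uniqueness of coefficients makes the sum of `c_l √b_l` over the words with a given
product vanish (`tsum_fiber_eq_zero`). If the product of `w` along a word depends only on the
product of `n`, then it factors out of each such sum and `g z = 0` (`IsDAMultiplier.apply_eq_zero`).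

What remains is combinatorial: the relations of the minimal dependent sets (circuits) must imply all
multiplicative relations for `w` (`prod_pow_eq_of_representations`). Where no `w i` vanishes, this
holds because primitive circuit relations generate the lattice of relations over `ℤ`
(`apply_eq_zero_of_circuits`). Zeros of `w` need a sign argument: a relation meeting the zero set on
one side also meets it on the other (`exists_neg_mem_of_circuits`). -/

/-- The integer relations between the logarithms of the `n_j`. -/
def logRelations {ι : Type} (n : ι → ℕ) : Submodule ℤ (ι →₀ ℤ) :=
  LinearMap.ker (Finsupp.linearCombination ℤ fun j => Real.log (n j))

/-! ### Integer relations and minimal dependent sets -/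

section Relations

variable {ι : Type} {n : ι → ℕ} {J : Set ι}

theorem mem_logRelations_iff_of_subset {v : ι →₀ ℤ} {S : Finset ι} (hS : v.support ⊆ S) :
    v ∈ logRelations n ↔ ∑ i ∈ S, (v i : ℝ) * Real.log (n i) = 0 := by
  rw [logRelations, LinearMap.mem_ker, Finsupp.linearCombination_apply,
    Finsupp.sum_of_support_subset _ hS _ (by simp)]
  simp

/-- Clearing denominators replaces rational relations by integer ones, since `ℚ` is the fraction
field of `ℤ`. -/
theorem log_linearIndepOn_iff :
    LinearIndepOn ℚ (fun j => Real.log (n j)) J ↔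
      ∀ v ∈ logRelations n, (v.support : Set ι) ⊆ J → v = 0 := by
  have h : LinearIndepOn ℚ (fun j => Real.log (n j)) J ↔
      LinearIndepOn ℤ (fun j => Real.log (n j)) J :=
    (LinearIndependent.iff_fractionRing ℤ ℚ).symm
  rw [h, linearIndepOn_iff]
  simp only [Finsupp.mem_supported, logRelations, LinearMap.mem_ker]
  exact ⟨fun h v hv hJ => h v hJ hv, fun h v hJ hv => h v hv hJ⟩

theorem exists_minimalDependentSets_subset {v : ι →₀ ℤ} (hv : v ∈ logRelations n) (h0 : v ≠ 0) :
    ∃ J ∈ minimalDependentSets n, J ⊆ v.support := by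
  classical
  have key : ∀ S : Finset ι, ¬ LinearIndepOn ℚ (fun j => Real.log (n j)) (S : Set ι) →
      ∃ J ∈ minimalDependentSets n, J ⊆ S := by
    intro S
    induction S using Finset.strongInduction with
    | H S ih =>
      intro hS
      by_cases h : ∀ I, I ⊂ (S : Set ι) → LinearIndepOn ℚ (fun j => Real.log (n j)) I
      · exact ⟨S, ⟨hS, h⟩, subset_rfl⟩
      · push Not at h
        obtain ⟨I, hIS, hI⟩ := h
        lift I to Finset ι using S.finite_toSet.subset hIS.1
        obtain ⟨J, hJ, hJI⟩ := ih I (by exact_mod_cast hIS) hI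
        exact ⟨J, hJ, hJI.trans hIS.1⟩
  exact key _ fun h => h0 (log_linearIndepOn_iff.1 h v hv subset_rfl)

theorem support_eq_of_mem_minimalDependentSets (hJ : J ∈ minimalDependentSets n) {v : ι →₀ ℤ}
    (hv : v ∈ logRelations n) (h0 : v ≠ 0) (hvJ : (v.support : Set ι) ⊆ J) :
    (v.support : Set ι) = J := by
  by_contra h
  exact h0 (log_linearIndepOn_iff.1 (hJ.2 _ (hvJ.ssubset_of_ne h)) v hv subset_rfl)

/-- Eliminating the coordinate `j` leaves a relation supported in a proper subset of `J`, which is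
zero by minimality. So the relations on a circuit form a group of rank one. -/
theorem smul_eq_smul_of_mem_minimalDependentSets (hJ : J ∈ minimalDependentSets n)
    {u v : ι →₀ ℤ} (hu : u ∈ logRelations n) (hv : v ∈ logRelations n)
    (huJ : (u.support : Set ι) ⊆ J) (hvJ : (v.support : Set ι) ⊆ J) {j : ι} (hj : j ∈ J) :
    u j • v = v j • u := by
  rw [← sub_eq_zero]
  have hmem : u j • v - v j • u ∈ logRelations n :=
    sub_mem (Submodule.smul_mem _ _ hv) (Submodule.smul_mem _ _ hu)
  by_contra h0
  have hsub : ((u j • v - v j • u).support : Set ι) ⊆ J := by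
    intro i hi
    by_contra hiJ
    have hui : u i = 0 := by simpa using fun h => hiJ (huJ h)
    have hvi : v i = 0 := by simpa using fun h => hiJ (hvJ h)
    simp [hui, hvi] at hi
  have := support_eq_of_mem_minimalDependentSets hJ hmem h0 hsub
  rw [← this] at hj
  simp [mul_comm] at hj

theorem sum_mul_log_eq_log_prod (hn : ∀ j, n j ≠ 0) (S : Finset ι) (α : ι → ℕ) :
    ∑ i ∈ S, (α i : ℝ) * Real.log (n i) = Real.log ((∏ i ∈ S, n i ^ α i : ℕ) : ℝ) := by
  push_cast
  rw [Real.log_prod fun i _ => pow_ne_zero _ (by exact_mod_cast hn i)]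
  simp

theorem sum_log_eq_of_prod_eq (hn : ∀ j, n j ≠ 0) {S T : Finset ι} {α β : ι → ℕ}
    (h : ∏ i ∈ S, n i ^ α i = ∏ i ∈ T, n i ^ β i) :
    ∑ i ∈ S, (α i : ℝ) * Real.log (n i) = ∑ i ∈ T, (β i : ℝ) * Real.log (n i) := by
  rw [sum_mul_log_eq_log_prod hn, sum_mul_log_eq_log_prod hn, h]

theorem prod_eq_of_sum_log_eq (hn : ∀ j, n j ≠ 0) {S T : Finset ι} {α β : ι → ℕ}
    (h : ∑ i ∈ S, (α i : ℝ) * Real.log (n i) = ∑ i ∈ T, (β i : ℝ) * Real.log (n i)) :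
    ∏ i ∈ S, n i ^ α i = ∏ i ∈ T, n i ^ β i := by
  have pos : ∀ (U : Finset ι) (γ : ι → ℕ), (0 : ℝ) < ((∏ i ∈ U, n i ^ γ i : ℕ) : ℝ) :=
    fun U γ => by exact_mod_cast Finset.prod_pos fun i _ => pow_pos (Nat.pos_of_ne_zero (hn i)) _
  rw [sum_mul_log_eq_log_prod hn, sum_mul_log_eq_log_prod hn] at h
  exact_mod_cast Real.log_injOn_pos (pos _ _) (pos _ _) h

/-- The integer relation that belongs to a representation. -/
theorem IsRepresentation.exists_relation (hn : ∀ j, n j ≠ 0) {J₁ J₂ : Finset ι} {β : ι →₀ ℕ}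
    (h : IsRepresentation n J J₁ J₂ β) :
    ∃ u ∈ logRelations n, (u.support : Set ι) = J ∧ (∀ i ∈ J₁, u i = β i) ∧
      ∀ i ∈ J₂, u i = -β i := by
  classical
  refine ⟨Finsupp.onFinset β.support (fun i => if i ∈ J₁ then (β i : ℤ) else -β i) ?_, ?_⟩
  · intro i hi
    rw [Finsupp.mem_support_iff]
    rintro h0
    simp [h0] at hi
  set u : ι →₀ ℤ := Finsupp.onFinset β.support (fun i => if i ∈ J₁ then (β i : ℤ) else -β i) _
  have h1 : ∀ i ∈ J₁, u i = β i := fun i hi => by simp [u, hi]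
  have h2 : ∀ i ∈ J₂, u i = -β i := fun i hi => by
    simp [u, Finset.disjoint_right.1 h.disjoint hi]
  have hsupp : u.support = β.support := by
    ext i
    by_cases hi : i ∈ J₁ <;> simp [u, hi]
  have hU : u.support = J₁ ∪ J₂ := by
    rw [hsupp]
    exact_mod_cast h.support_eq.trans h.union_eq.symm
  refine ⟨?_, by rw [hsupp, h.support_eq], h1, h2⟩
  rw [mem_logRelations_iff_of_subset hU.subset, Finset.sum_union h.disjoint,
    Finset.sum_congr rfl fun i hi => by rw [h1 i hi],
    Finset.sum_congr (s₁ := J₂) rfl fun i hi => by rw [h2 i hi]]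
  simpa [add_neg_eq_zero] using sum_log_eq_of_prod_eq hn h.prod_eq

/-- A nonzero integer relation on `J` has all of `J` as its support. Divide it by the gcd of its
entries and split the indices by sign. -/
theorem exists_isRepresentation (hn : ∀ j, 2 ≤ n j) (hJ : J ∈ minimalDependentSets n) :
    ∃ (J₁ J₂ : Finset ι) (β : ι →₀ ℕ), IsRepresentation n J J₁ J₂ β := by
  classical
  obtain ⟨v, hv, hvJ, h0⟩ : ∃ v ∈ logRelations n, (v.support : Set ι) ⊆ J ∧ v ≠ 0 := by
    have := hJ.1
    rw [log_linearIndepOn_iff] at this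
    push Not at this
    exact this
  have hlog : ∀ i, 0 < Real.log (n i) := fun i =>
    Real.log_pos (by exact_mod_cast (hn i : 1 < n i))
  have hsupp := support_eq_of_mem_minimalDependentSets hJ hv h0 hvJ
  have hsum := (mem_logRelations_iff_of_subset subset_rfl).1 hv
  obtain ⟨k, hk⟩ := Finsupp.support_nonempty_iff.2 h0
  set G := v.support.gcd fun i => (v i).natAbs
  have hG : G ≠ 0 := fun h => by
    have := Finset.gcd_eq_zero_iff.1 h k hk
    simp at this hk
    exact hk this
  have hdvd : ∀ i, G ∣ (v i).natAbs := fun i => by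
    by_cases hi : i ∈ v.support
    · exact Finset.gcd_dvd hi
    · simp [Finsupp.notMem_support_iff.1 hi]
  let β : ι →₀ ℕ := v.mapRange (fun a => a.natAbs / G) (by simp)
  have hβ : ∀ i, (v i).natAbs = G * β i := fun i => (Nat.mul_div_cancel' (hdvd i)).symm
  have hβs : β.support = v.support := by
    ext i
    have := hβ i
    simp only [Finsupp.mem_support_iff, ne_eq, not_iff_not]
    rw [← Int.natAbs_eq_zero, this]
    simp [hG]
  let J₁ := v.support.filter fun i => 0 < v i
  let J₂ := v.support.filter fun i => ¬ 0 < v i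
  have e1 : ∀ i ∈ J₁, (v i : ℝ) = G * β i := fun i hi => by
    have h1 := (Finset.mem_filter.1 hi).2
    have h2 : v i = ((v i).natAbs : ℤ) := by omega
    rw [h2, hβ i]; push_cast; rfl
  have e2 : ∀ i ∈ J₂, (v i : ℝ) = -(G * β i) := fun i hi => by
    have h1 := (Finset.mem_filter.1 hi).2
    have h2 : v i = -((v i).natAbs : ℤ) := by omega
    rw [h2, hβ i]; push_cast; rfl
  have heq : ∑ i ∈ J₁, (β i : ℝ) * Real.log (n i) = ∑ i ∈ J₂, (β i : ℝ) * Real.log (n i) := by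
    rw [← Finset.sum_filter_add_sum_filter_not v.support (fun i => 0 < v i)] at hsum
    change ∑ i ∈ J₁, _ + ∑ i ∈ J₂, _ = _ at hsum
    rw [Finset.sum_congr (s₁ := J₁) rfl fun i hi => by rw [e1 i hi],
      Finset.sum_congr (s₁ := J₂) rfl fun i hi => by rw [e2 i hi]] at hsum
    simp only [neg_mul, Finset.sum_neg_distrib, mul_assoc, ← Finset.mul_sum] at hsum
    have hG' : (G : ℝ) ≠ 0 := by exact_mod_cast hG
    rw [add_neg_eq_zero] at hsum
    exact mul_left_cancel₀ hG' hsum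
  have hβpos : ∀ i ∈ v.support, (0 : ℝ) < β i := fun i hi => by
    rw [← hβs, Finsupp.mem_support_iff] at hi
    exact_mod_cast Nat.pos_of_ne_zero hi
  have hunion : J₁ ∪ J₂ = v.support := Finset.filter_union_filter_not_eq _ _
  have posSum : ∀ T ⊆ v.support, T.Nonempty → 0 < ∑ i ∈ T, (β i : ℝ) * Real.log (n i) :=
    fun T hT hTn => Finset.sum_pos (fun i hi => mul_pos (hβpos i (hT hi)) (hlog i)) hTn
  -- All `log (n i)` are positive, so a relation cannot have entries of one sign only.
  have hne : J₁.Nonempty ∧ J₂.Nonempty := by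
    rcases J₁.eq_empty_or_nonempty with h1 | h1 <;> rcases J₂.eq_empty_or_nonempty with h2 | h2
    · rw [h1, h2, Finset.empty_union] at hunion
      simp [← hunion] at hk
    · have := posSum J₂ (Finset.filter_subset _ _) h2
      rw [← heq, h1] at this
      simp at this
    · have := posSum J₁ (Finset.filter_subset _ _) h1
      rw [heq, h2] at this
      simp at this
    · exact ⟨h1, h2⟩
  refine ⟨J₁, J₂, β, hne.1, hne.2, Finset.disjoint_filter_filter_not _ _ _, ?_, ?_, ?_, ?_⟩
  · rw [← hsupp, ← hunion, Finset.coe_union]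
  · rw [hβs, hsupp]
  · rw [hβs]
    exact Finset.gcd_div_eq_one hk (by simpa using hk)
  · exact prod_eq_of_sum_log_eq (fun j => by have := hn j; omega) heq

/-- Two representations give proportional integer relations. Coprimality makes the factor `±1`, and
the sign `-1` swaps the two parts. -/
theorem IsRepresentation.unique (hn : ∀ j, n j ≠ 0) (hJ : J ∈ minimalDependentSets n)
    {J₁ J₂ I₁ I₂ : Finset ι} {β γ : ι →₀ ℕ} (hβ : IsRepresentation n J J₁ J₂ β)
    (hγ : IsRepresentation n J I₁ I₂ γ) :
    γ = β ∧ (I₁ = J₁ ∧ I₂ = J₂ ∨ I₁ = J₂ ∧ I₂ = J₁) := by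
  classical
  -- A representation can be read off from its relation: the exponents are the absolute values, the
  -- parts the sign sets.
  have abs : ∀ {K₁ K₂ : Finset ι} {δ : ι →₀ ℕ} {u : ι →₀ ℤ}, IsRepresentation n J K₁ K₂ δ →
      (u.support : Set ι) = J → (∀ i ∈ K₁, u i = δ i) → (∀ i ∈ K₂, u i = -δ i) →
      (∀ i, (u i).natAbs = δ i) ∧ (∀ i, i ∈ K₁ ↔ 0 < u i) ∧ (∀ i, i ∈ K₂ ↔ u i < 0) := by
    intro K₁ K₂ δ u h hu h1 h2
    have hδ : ∀ i, i ∈ J → 0 < δ i := fun i hi => by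
      rw [← h.support_eq] at hi
      exact Nat.pos_of_ne_zero (by simpa using hi)
    have m1 : ∀ i ∈ K₁, i ∈ J := fun i hi => h.union_eq ▸ Or.inl hi
    have m2 : ∀ i ∈ K₂, i ∈ J := fun i hi => h.union_eq ▸ Or.inr hi
    have m : ∀ i, i ∈ K₁ ∨ i ∈ K₂ ∨ (u i = 0 ∧ δ i = 0 ∧ i ∉ K₁ ∧ i ∉ K₂) := by
      intro i
      by_cases hi : i ∈ J
      · have : i ∈ (K₁ : Set ι) ∪ K₂ := h.union_eq ▸ hi
        rcases this with h' | h'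
        · exact Or.inl h'
        · exact Or.inr (Or.inl h')
      · refine Or.inr (Or.inr ⟨?_, ?_, fun h' => hi (m1 i h'), fun h' => hi (m2 i h')⟩)
        · rw [← hu] at hi; simpa using hi
        · rw [← h.support_eq] at hi; simpa using hi
    have hd : ∀ i, i ∈ K₁ → i ∉ K₂ := fun i hi => Finset.disjoint_left.1 h.disjoint hi
    refine ⟨fun i => ?_, fun i => ?_, fun i => ?_⟩ <;>
      rcases m i with h' | h' | ⟨h3, h4, h5, h6⟩
    · simp [h1 i h']
    · simp [h2 i h']
    · simp [h3, h4]
    · simp [h', h1 i h', hδ i (m1 i h')]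
    · have : i ∉ K₁ := fun h'' => hd i h'' h'
      simp [h2 i h', this]
    · simp [h3, h5]
    · simp [h1 i h', hd i h']
    · simp [h', h2 i h', hδ i (m2 i h')]
    · simp [h3, h6]
  obtain ⟨u, hu, huJ, hu1, hu2⟩ := hβ.exists_relation hn
  obtain ⟨v, hv, hvJ, hv1, hv2⟩ := hγ.exists_relation hn
  obtain ⟨ua, up, un⟩ := abs hβ huJ hu1 hu2
  obtain ⟨va, vp, vn⟩ := abs hγ hvJ hv1 hv2
  obtain ⟨j, hj₁⟩ := hβ.nonempty_left
  have hj : j ∈ J := hβ.union_eq ▸ Or.inl hj₁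
  have hprop : ∀ i, u j * v i = v j * u i := fun i => by
    simpa using DFunLike.congr_fun
      (smul_eq_smul_of_mem_minimalDependentSets hJ hu hv huJ.subset hvJ.subset hj) i
  have hprop' : ∀ i, β j * γ i = γ j * β i := fun i => by
    rw [← ua, ← va, ← ua, ← va, ← Int.natAbs_mul, ← Int.natAbs_mul, hprop]
  have hs : γ.support = β.support := by
    exact_mod_cast hγ.support_eq.trans hβ.support_eq.symm
  have hjj : β j = γ j := by
    have h1 : β.support.gcd (fun i => β j * γ i) = β j := by
      rw [Finset.gcd_mul_left, ← hs, hγ.gcd_eq_one]; simp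
    have h2 : β.support.gcd (fun i => γ j * β i) = γ j := by
      rw [Finset.gcd_mul_left, hβ.gcd_eq_one]; simp
    rw [← h1, ← h2]
    simp only [hprop']
  have hβj : β j ≠ 0 := by
    rw [← hβ.support_eq] at hj
    simpa using hj
  refine ⟨?_, ?_⟩
  · ext i
    have := hprop' i
    rw [← hjj] at this
    exact Nat.eq_of_mul_eq_mul_left (Nat.pos_of_ne_zero hβj) this
  · have huj : u j = β j := hu1 j hj₁
    have hvj : v j = β j ∨ v j = -β j := by
      rw [hjj, ← va j]
      exact Int.natAbs_eq _
    have hβj' : (β j : ℤ) ≠ 0 := by exact_mod_cast hβj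
    rcases hvj with hvj | hvj
    · have huv : ∀ i, v i = u i := fun i => by
        have := hprop i
        rw [huj, hvj] at this
        exact mul_left_cancel₀ hβj' this
      left
      constructor <;> ext i
      · rw [vp, up, huv]
      · rw [vn, un, huv]
    · have huv : ∀ i, v i = -u i := fun i => by
        have := hprop i
        rw [huj, hvj, neg_mul, ← mul_neg] at this
        exact mul_left_cancel₀ hβj' this
      right
      constructor <;> ext i
      · rw [vp, un, huv]; omega
      · rw [vn, up, huv]; omega

end Relations

/-! ### Elimination along circuits -/

section Circuits

variable {ι : Type} {n : ι → ℕ}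

/-- A homomorphism that kills a primitive relation on every minimal dependent subset of `F` kills
all relations supported in `F`. -/
theorem apply_eq_zero_of_circuits {A : Type*} [AddCommGroup A] (χ : (ι →₀ ℤ) →+ A) (F : Set ι)
    (h : ∀ J ∈ minimalDependentSets n, J ⊆ F → ∃ u ∈ logRelations n, (u.support : Set ι) = J ∧
      (∀ p : ℕ, p.Prime → ∃ i ∈ J, ¬ (p : ℤ) ∣ u i) ∧ χ u = 0)
    {v : ι →₀ ℤ} (hv : v ∈ logRelations n) (hvF : (v.support : Set ι) ⊆ F) : χ v = 0 := by
  classical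
  -- If `χ v ≠ 0`, some prime `p` divides its additive order (order `0` being divisible by every
  -- prime). The contradiction comes from an integer prime to `p` that kills `χ v`, found by
  -- induction on the size of the support.
  by_contra hχ
  rw [← AddMonoid.addOrderOf_eq_one_iff] at hχ
  obtain ⟨p, hp, hpdvd⟩ := Nat.exists_prime_and_dvd hχ
  have key : ∀ (m : ℕ) (v : ι →₀ ℤ), v.support.card ≤ m → v ∈ logRelations n →
      (v.support : Set ι) ⊆ F → ∃ M : ℤ, ¬ (p : ℤ) ∣ M ∧ M • χ v = 0 := by
    intro m
    induction m with
    | zero =>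
      intro v hm _ _
      have : v = 0 := by simpa using hm
      exact ⟨1, by exact_mod_cast hp.one_lt.ne' ∘ Nat.dvd_one.1, by simp [this]⟩
    | succ m ih =>
      intro v hm hv hvF
      by_cases h0 : v = 0
      · exact ⟨1, by exact_mod_cast hp.one_lt.ne' ∘ Nat.dvd_one.1, by simp [h0]⟩
      obtain ⟨J, hJ, hJv⟩ := exists_minimalDependentSets_subset hv h0
      obtain ⟨u, hu, huJ, hup, hχu⟩ := h J hJ (hJv.trans hvF)
      obtain ⟨i, hiJ, hpi⟩ := hup p hp
      -- The entry at `i` cancels, and `χ v' = u i • χ v` with a factor prime to `p`.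
      set v' := u i • v - v i • u
      have hsub : v'.support ⊆ v.support.erase i := by
        intro k hk
        rw [Finset.mem_erase]
        refine ⟨?_, ?_⟩
        · rintro rfl
          simp [v', mul_comm] at hk
        · by_contra hkv
          have huk : u k = 0 := by
            have : k ∉ (u.support : Set ι) := fun h' => hkv (hJv (huJ ▸ h'))
            simpa using this
          simp [v', Finsupp.notMem_support_iff.1 hkv, huk] at hk
      have hcard : v'.support.card ≤ m := by
        have h1 := Finset.card_le_card hsub
        rw [Finset.card_erase_of_mem (hJv hiJ)] at h1
        omega
      obtain ⟨M, hM, hMχ⟩ := ih v' hcard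
        (sub_mem (Submodule.smul_mem _ _ hv) (Submodule.smul_mem _ _ hu))
        (fun k hk => hvF (Finset.mem_of_mem_erase (hsub hk)))
      refine ⟨M * u i, fun hd => ?_, ?_⟩
      · exact ((Nat.prime_iff_prime_int.1 hp).dvd_or_dvd hd).elim hM hpi
      · simpa [v', map_sub, map_zsmul, hχu, mul_smul] using hMχ
  obtain ⟨M, hM, hMχ⟩ := key _ v le_rfl hv hvF
  exact hM ((Int.natCast_dvd_natCast.2 hpdvd).trans (addOrderOf_dvd_iff_zsmul_eq_zero.2 hMχ))

/-- If every minimal dependent set carries a relation whose positive part meets `Z` exactly if its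
negative part does, then every relation whose positive part meets `Z` has a negative part that
meets `Z`. -/
theorem exists_neg_mem_of_circuits (Z : Set ι)
    (h : ∀ J ∈ minimalDependentSets n, ∃ u ∈ logRelations n, (u.support : Set ι) = J ∧
      ((∃ i ∈ Z, 0 < u i) ↔ ∃ i ∈ Z, u i < 0))
    {v : ι →₀ ℤ} (hv : v ∈ logRelations n) {j : ι} (hj : 0 < v j) (hjZ : j ∈ Z) :
    ∃ i ∈ Z, v i < 0 := by
  classical
  have key : ∀ (m : ℕ) (v : ι →₀ ℤ), v.support.card ≤ m → v ∈ logRelations n → 0 < v j →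
      ∃ i ∈ Z, v i < 0 := by
    intro m
    induction m with
    | zero =>
      intro v hm _ hj
      have : v = 0 := by simpa using hm
      simp [this] at hj
    | succ m ih =>
      intro v hm hv hj
      obtain ⟨J, hJ, hJv⟩ := exists_minimalDependentSets_subset hv (by rintro rfl; simp at hj)
      -- The inductive step: subtract from `v` a multiple of `u` that agrees with `v` in sign
      -- somewhere. The condition `u j ≤ 0` keeps the entry at `j` positive.
      have step : ∀ u ∈ logRelations n, (∀ i, v i = 0 → u i = 0) → u j ≤ 0 →
          (∃ i, 0 < u i * v i) → ∃ i ∈ Z, v i < 0 := by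
        rintro u hu huv huj ⟨i₀, hi₀⟩
        have hmem : ∀ i, i ∈ v.support.filter (fun i => 0 < u i * v i) ↔ 0 < u i * v i := by
          intro i
          simp only [Finset.mem_filter, Finsupp.mem_support_iff, and_iff_right_iff_imp]
          rintro h1 h2
          simp [h2] at h1
        -- The minimal ratio among the entries of equal sign lets the entry at `i` cancel without
        -- any nonnegative entry of `v` becoming negative.
        obtain ⟨i, hi, hmin⟩ := Finset.exists_min_image
          (v.support.filter fun i => 0 < u i * v i) (fun i => (|v i| : ℚ) / |u i|)
          ⟨i₀, (hmem i₀).2 hi₀⟩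
        rw [hmem] at hi
        have hmin' : ∀ k, 0 < u k * v k → |v i| * |u k| ≤ |v k| * |u i| := fun k hk => by
          have h1 := hmin k ((hmem k).2 hk)
          have h2 : u k ≠ 0 := by rintro h2; simp [h2] at hk
          have h3 : u i ≠ 0 := by rintro h2; simp [h2] at hi
          rw [div_le_div_iff₀ (by positivity) (by positivity)] at h1
          exact_mod_cast h1
        have hui : u i ≠ 0 := by rintro h2; simp [h2] at hi
        have hvi : v i ≠ 0 := by rintro h2; simp [h2] at hi
        set v' := |u i| • v - |v i| • u
        have hv' : ∀ k, v' k = |u i| * v k - |v i| * u k := fun k => by simp [v']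
        have hsub : v'.support ⊆ v.support.erase i := by
          intro k hk
          rw [Finset.mem_erase]
          rw [Finsupp.mem_support_iff, hv'] at hk
          refine ⟨?_, ?_⟩
          · rintro rfl
            apply hk
            rcases pos_and_pos_or_neg_and_neg_of_mul_pos hi with ⟨h1, h2⟩ | ⟨h1, h2⟩
            · rw [abs_of_pos h1, abs_of_pos h2]; ring
            · rw [abs_of_neg h1, abs_of_neg h2]; ring
          · rw [Finsupp.mem_support_iff]
            intro hk0
            simp [hk0, huv k hk0] at hk
        have hcard : v'.support.card ≤ m := by
          have h1 := Finset.card_le_card hsub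
          rw [Finset.card_erase_of_mem (by simpa using hvi)] at h1
          omega
        have hpu : 0 < |u i| := abs_pos.2 hui
        have hpv : 0 < |v i| := abs_pos.2 hvi
        obtain ⟨k, hkZ, hk⟩ := ih v' hcard
          (sub_mem (Submodule.smul_mem _ _ hv) (Submodule.smul_mem _ _ hu))
          (by rw [hv']; nlinarith)
        refine ⟨k, hkZ, ?_⟩
        by_contra! hk0
        rw [hv'] at hk
        rcases hk0.eq_or_lt with hk0 | hk0
        · simp [← hk0, huv k hk0.symm] at hk
        · rcases le_or_gt (u k) 0 with h1 | h1
          · nlinarith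
          · have := hmin' k (mul_pos h1 hk0)
            rw [abs_of_pos h1, abs_of_pos hk0] at this
            linarith
      -- The circuit relation is taken with `u j ≥ 0`; if `u j = 0`, its sign is chosen so that it
      -- opposes `v` somewhere.
      obtain ⟨u, hu, huv, huj, huZ, i, hi⟩ : ∃ u ∈ logRelations n, (∀ i, v i = 0 → u i = 0) ∧
          0 ≤ u j ∧ ((∃ i ∈ Z, 0 < u i) ↔ ∃ i ∈ Z, u i < 0) ∧
          ∃ i, (u i ≠ 0 ∧ (u j = 0 → u i * v i < 0)) := by
        obtain ⟨u, hu, huJ, huZ⟩ := h J hJ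
        have huv : ∀ i, v i = 0 → u i = 0 := fun i hi => by
          have : i ∉ (u.support : Set ι) := fun h' => by
            rw [huJ] at h'
            exact Finsupp.mem_support_iff.1 (hJv h') hi
          simpa using this
        obtain ⟨i, hi⟩ : ∃ i, u i ≠ 0 := by
          by_contra! h0
          have hu0 : u = 0 := Finsupp.ext h0
          rw [hu0] at huJ
          refine hJ.1 (log_linearIndepOn_iff.2 fun w _ hw => ?_)
          simpa [← huJ] using hw
        have hvi : v i ≠ 0 := fun h' => hi (huv i h')
        have hneg : ((∃ i ∈ Z, 0 < (-u) i) ↔ ∃ i ∈ Z, (-u) i < 0) := by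
          simpa using huZ.symm
        have huv' : ∀ i, v i = 0 → (-u) i = 0 := fun i hi => by simpa using huv i hi
        have hui' : (-u) i ≠ 0 := by simpa using hi
        rcases lt_trichotomy (u j) 0 with h1 | h1 | h1
        · exact ⟨-u, neg_mem hu, huv', by simpa using h1.le, hneg, i, hui', fun h2 => by
            simp at h2; omega⟩
        · rcases lt_or_gt_of_ne (mul_ne_zero hi hvi) with h2 | h2
          · exact ⟨u, hu, huv, h1.ge, huZ, i, hi, fun _ => h2⟩
          · exact ⟨-u, neg_mem hu, huv', by simp [h1], hneg, i, hui', fun _ => by simpa using h2⟩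
        · exact ⟨u, hu, huv, h1.le, huZ, i, hi, fun h2 => by omega⟩
      -- If `u` opposes `v` somewhere, `-u` serves for elimination. Otherwise the signs of `u` are
      -- those of `v` on the support of `u`, and the hypothesis on the circuit yields the index
      -- directly.
      by_cases hA : ∃ i, u i * v i < 0
      · obtain ⟨k, hk⟩ := hA
        exact step (-u) (neg_mem hu) (fun i hi => by simpa using huv i hi) (by simpa using huj)
          ⟨k, by simpa using hk⟩
      · push Not at hA
        have huj' : 0 < u j := huj.lt_of_ne fun h0 => (hi.2 h0.symm).not_ge (hA i)
        obtain ⟨k, hkZ, hk⟩ := huZ.1 ⟨j, hjZ, huj'⟩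
        refine ⟨k, hkZ, ?_⟩
        have hvk : v k ≠ 0 := fun h0 => hk.ne (huv k h0)
        have := hA k
        by_contra! hvk'
        have : 0 < v k := hvk'.lt_of_ne hvk.symm
        nlinarith
  exact key _ v le_rfl hv hj

end Circuits

/-! ### From circuit binomials to all multiplicative relations -/

section Toric

variable {ι : Type} {n : ι → ℕ} {w : ι → ℂ}

/-- A point at which the binomials of all minimal dependent sets vanish respects all
multiplicative relations between the `n_j`. -/
theorem prod_pow_eq_of_representations (hn : ∀ j, n j ≠ 0)
    (hw : ∀ J ∈ minimalDependentSets n, ∃ (J₁ J₂ : Finset ι) (β : ι →₀ ℕ),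
      IsRepresentation n J J₁ J₂ β ∧ ∏ i ∈ J₁, w i ^ β i = ∏ i ∈ J₂, w i ^ β i)
    {S : Finset ι} {α α' : ι → ℕ} (h : ∏ i ∈ S, n i ^ α i = ∏ i ∈ S, n i ^ α' i) :
    ∏ i ∈ S, w i ^ α i = ∏ i ∈ S, w i ^ α' i := by
  classical
  have hβ0 : ∀ {J : Set ι} {J₁ J₂ : Finset ι} {β : ι →₀ ℕ}, IsRepresentation n J J₁ J₂ β →
      ∀ i, i ∈ J₁ ∨ i ∈ J₂ → 0 < β i := fun {J J₁ J₂ β} hr i hi => by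
    have : i ∈ (J₁ : Set ι) ∪ J₂ := hi
    rw [hr.union_eq, ← hr.support_eq] at this
    exact Nat.pos_of_ne_zero (by simpa using this)
  have hZ : ∀ J ∈ minimalDependentSets n, ∃ u ∈ logRelations n, (u.support : Set ι) = J ∧
      ((∃ i ∈ {i | w i = 0}, 0 < u i) ↔ ∃ i ∈ {i | w i = 0}, u i < 0) := by
    intro J hJ
    obtain ⟨J₁, J₂, β, hr, he⟩ := hw J hJ
    obtain ⟨u, hu, huJ, hu1, hu2⟩ := hr.exists_relation hn
    have hmem : ∀ i, u i ≠ 0 → i ∈ J₁ ∨ i ∈ J₂ := fun i hi => by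
      have : i ∈ (u.support : Set ι) := by simpa using hi
      rw [huJ, ← hr.union_eq] at this
      exact this
    have z1 : (∃ i ∈ {i | w i = 0}, 0 < u i) ↔ ∏ i ∈ J₁, w i ^ β i = 0 := by
      rw [Finset.prod_eq_zero_iff]
      constructor
      · rintro ⟨i, hi, hui⟩
        rcases hmem i hui.ne' with h1 | h1
        · exact ⟨i, h1, by rw [Set.mem_ofPred_eq] at hi; simp [hi, (hβ0 hr i (Or.inl h1)).ne']⟩
        · rw [hu2 i h1] at hui; omega
      · rintro ⟨i, hi, hwi⟩
        refine ⟨i, eq_zero_of_pow_eq_zero hwi, ?_⟩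
        rw [hu1 i hi]
        exact_mod_cast hβ0 hr i (Or.inl hi)
    have z2 : (∃ i ∈ {i | w i = 0}, u i < 0) ↔ ∏ i ∈ J₂, w i ^ β i = 0 := by
      rw [Finset.prod_eq_zero_iff]
      constructor
      · rintro ⟨i, hi, hui⟩
        rcases hmem i hui.ne with h1 | h1
        · rw [hu1 i h1] at hui; omega
        · exact ⟨i, h1, by rw [Set.mem_ofPred_eq] at hi; simp [hi, (hβ0 hr i (Or.inr h1)).ne']⟩
      · rintro ⟨i, hi, hwi⟩
        refine ⟨i, eq_zero_of_pow_eq_zero hwi, ?_⟩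
        rw [hu2 i hi]
        have := hβ0 hr i (Or.inr hi)
        omega
    exact ⟨u, hu, huJ, by rw [z1, z2, he]⟩
  let v : ι →₀ ℤ := Finsupp.onFinset S (fun i => if i ∈ S then (α i : ℤ) - α' i else 0)
    fun i hi => by by_contra h; simp [h] at hi
  have hvS : ∀ i ∈ S, v i = α i - α' i := fun i hi => by simp [v, hi]
  have hvS' : ∀ i, v i ≠ 0 → i ∈ S := fun i hi => by by_contra h; simp [v, h] at hi
  have hv : v ∈ logRelations n := by
    rw [mem_logRelations_iff_of_subset (S := S)
      (fun i hi => hvS' i (Finsupp.mem_support_iff.1 hi)),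
      Finset.sum_congr rfl fun i hi => by rw [hvS i hi]]
    simpa [sub_mul, sub_eq_zero] using sum_log_eq_of_prod_eq hn h
  have both : ∀ i ∈ S, ∀ k ∈ S, w i = 0 → w k = 0 → α i ≠ 0 → α' k ≠ 0 →
      ∏ i ∈ S, w i ^ α i = ∏ i ∈ S, w i ^ α' i := fun i hi k hk hwi hwk hαi hαk => by
    rw [Finset.prod_eq_zero hi (by simp [hwi, hαi]), Finset.prod_eq_zero hk (by simp [hwk, hαk])]
  -- If the difference of the exponents is nonzero at a zero of `w`, the sign argument makes both
  -- products vanish.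
  by_cases hbad : ∃ i, w i = 0 ∧ v i ≠ 0
  · obtain ⟨i, hwi, hvi⟩ := hbad
    have hi := hvS' i hvi
    rcases lt_or_gt_of_ne hvi with h1 | h1
    · obtain ⟨k, hwk, hk⟩ := exists_neg_mem_of_circuits {i | w i = 0} hZ (neg_mem hv)
        (j := i) (by simpa using h1) hwi
      rw [Finsupp.neg_apply] at hk
      have hkS := hvS' k (by omega)
      rw [hvS k hkS] at hk
      rw [hvS i hi] at h1
      exact both k hkS i hi hwk hwi (by omega) (by omega)
    · obtain ⟨k, hwk, hk⟩ := exists_neg_mem_of_circuits {i | w i = 0} hZ hv h1 hwi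
      have hkS := hvS' k (by omega)
      rw [hvS k hkS] at hk
      rw [hvS i hi] at h1
      exact both i hi k hkS hwi hwk (by omega) (by omega)
  push Not at hbad
  have hαα' : ∀ i ∈ S, w i = 0 → α i = α' i := fun i hi hwi => by
    have := hbad i hwi
    rw [hvS i hi] at this
    omega
  by_cases hex : ∃ i ∈ S, w i = 0 ∧ α i ≠ 0
  · obtain ⟨i, hi, hwi, hαi⟩ := hex
    exact both i hi i hi hwi hwi hαi (hαα' i hi hwi ▸ hαi)
  push Not at hex
  -- The value `1` at the zeros of `w` is harmless: the exponents there are now zero on both sides.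
  let W : ι → ℂˣ := fun i => if h : w i = 0 then 1 else Units.mk0 (w i) h
  have hW : ∀ i, w i ≠ 0 → (W i : ℂ) = w i := fun i hi => by simp [W, hi]
  let χ : (ι →₀ ℤ) →+ Additive ℂˣ :=
    Finsupp.liftAddHom fun i => zmultiplesHom (Additive ℂˣ) (Additive.ofMul (W i))
  have hχ : ∀ (T : Finset ι) (u : ι →₀ ℤ), u.support ⊆ T →
      χ u = ∑ i ∈ T, u i • Additive.ofMul (W i) := fun T u hT => by
    simp only [χ, Finsupp.liftAddHom_apply]
    exact Finsupp.sum_of_support_subset _ hT _ (by simp)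
  have hprod : ∀ (T : Finset ι) (γ : ι → ℕ),
      ∑ i ∈ T, (γ i : ℤ) • Additive.ofMul (W i) = Additive.ofMul (∏ i ∈ T, W i ^ γ i) :=
    fun T γ => by simp [ofMul_prod]
  have hχv : χ v = 0 := by
    refine apply_eq_zero_of_circuits χ {i | w i ≠ 0} (fun J hJ hJF => ?_) hv
      (fun i hi => fun hwi => Finsupp.mem_support_iff.1 hi (hbad i hwi))
    obtain ⟨J₁, J₂, β, hr, he⟩ := hw J hJ
    obtain ⟨u, hu, huJ, hu1, hu2⟩ := hr.exists_relation hn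
    refine ⟨u, hu, huJ, fun p hp => ?_, ?_⟩
    -- A prime dividing all entries of `u` would divide the gcd of `β`, which is `1`.
    · by_contra! hall
      have : p ∣ β.support.gcd β := by
        refine Finset.dvd_gcd fun i hi => ?_
        have hiJ : i ∈ J := hr.support_eq ▸ hi
        have hd := hall i hiJ
        rw [← hr.union_eq] at hiJ
        rcases hiJ with h1 | h1
        · rw [hu1 i h1] at hd
          exact_mod_cast hd
        · rw [hu2 i h1, dvd_neg] at hd
          exact_mod_cast hd
      rw [hr.gcd_eq_one] at this
      exact hp.one_lt.ne' (Nat.dvd_one.1 this)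
    · have hU : u.support ⊆ J₁ ∪ J₂ := by
        have : (u.support : Set ι) = (J₁ ∪ J₂ : Finset ι) := by
          rw [huJ, Finset.coe_union, hr.union_eq]
        exact_mod_cast this.subset
      have hWJ : ∀ T : Finset ι, (T : Set ι) ⊆ J →
          ((∏ i ∈ T, W i ^ β i : ℂˣ) : ℂ) = ∏ i ∈ T, w i ^ β i := fun T hT => by
        push_cast
        exact Finset.prod_congr rfl fun i hi => by rw [hW i (hJF (hT hi))]
      have heW : ∏ i ∈ J₁, W i ^ β i = ∏ i ∈ J₂, W i ^ β i := by
        ext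
        rw [hWJ _ fun i hi => hr.union_eq ▸ Or.inl hi, hWJ _ fun i hi => hr.union_eq ▸ Or.inr hi, he]
      rw [hχ _ u hU, Finset.sum_union hr.disjoint,
        Finset.sum_congr (s₁ := J₁) rfl fun i hi => by rw [hu1 i hi],
        Finset.sum_congr (s₁ := J₂) rfl fun i hi => by rw [hu2 i hi, neg_smul],
        Finset.sum_neg_distrib, hprod, hprod, heW, add_neg_cancel]
  rw [hχ S v fun i hi => hvS' i (Finsupp.mem_support_iff.1 hi),
    Finset.sum_congr rfl fun i hi => by rw [hvS i hi, sub_smul], Finset.sum_sub_distrib,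
    hprod, hprod, sub_eq_zero] at hχv
  have hWS := congrArg (fun x : ℂˣ => (x : ℂ)) (Additive.ofMul.injective hχv)
  push_cast at hWS
  convert hWS using 1 <;> refine Finset.prod_congr rfl fun i hi => ?_
  · by_cases hwi : w i = 0
    · simp [hex i hi hwi]
    · rw [hW i hwi]
  · by_cases hwi : w i = 0
    · simp [← hαα' i hi hwi, hex i hi hwi]
    · rw [hW i hwi]

/-- Only the letter counts of the words matter, so `List.count` provides the exponents. -/
theorem list_prod_eq_of_representations (hn : ∀ j, n j ≠ 0)
    (hw : ∀ J ∈ minimalDependentSets n, ∃ (J₁ J₂ : Finset ι) (β : ι →₀ ℕ),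
      IsRepresentation n J J₁ J₂ β ∧ ∏ i ∈ J₁, w i ^ β i = ∏ i ∈ J₂, w i ^ β i)
    {l l' : List ι} (h : (l.map n).prod = (l'.map n).prod) :
    (l.map w).prod = (l'.map w).prod := by
  classical
  have key : ∀ {M : Type} [CommMonoid M] (f : ι → M) (m : List ι),
      m.toFinset ⊆ l.toFinset ∪ l'.toFinset →
      (m.map f).prod = ∏ i ∈ l.toFinset ∪ l'.toFinset, f i ^ m.count i := by
    intro M _ f m hm
    rw [Finset.prod_list_map_count]
    refine Finset.prod_subset hm fun i _ hi => ?_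
    rw [List.count_eq_zero_of_not_mem (by simpa using hi), pow_zero]
  rw [key n l Finset.subset_union_left, key n l' Finset.subset_union_right] at h
  rw [key w l Finset.subset_union_left, key w l' Finset.subset_union_right]
  exact prod_pow_eq_of_representations hn hw h

/-- A point is a zero of the binomial of a representation exactly if the rescaled point
`z_j / √b_j` satisfies the corresponding multiplicative relation. -/
theorem mem_polyZeroSet_binomialPoly_iff {b : ι → ℝ} (hb : ∀ j, 0 < b j) {J₁ J₂ : Finset ι}
    {β : ι →₀ ℕ} {z : HilbertCd ι} (hz : ∀ j, z j = (√(b j) : ℂ) * w j) :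
    z ∈ polyZeroSet (binomialPoly b J₁ J₂ β) ↔
      ∏ i ∈ J₁, w i ^ β i = ∏ i ∈ J₂, w i ^ β i := by
  have hpow : ∀ T : Finset ι, ((∏ i ∈ T, b i ^ ((β i : ℝ) / 2) : ℝ) : ℂ) =
      ∏ i ∈ T, (√(b i) : ℂ) ^ β i := fun T => by
    push_cast
    refine Finset.prod_congr rfl fun i _ => ?_
    rw [← Complex.ofReal_pow, Real.sqrt_eq_rpow, ← Real.rpow_natCast, ← Real.rpow_mul (hb i).le]
    ring_nf
  have h0 : ∀ T : Finset ι, ∏ i ∈ T, (√(b i) : ℂ) ^ β i ≠ 0 := fun T =>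
    Finset.prod_ne_zero_iff.2 fun i _ => pow_ne_zero _
      (Complex.ofReal_ne_zero.2 (Real.sqrt_pos.2 (hb i)).ne')
  simp only [polyZeroSet, Set.mem_ofPred_eq, binomialPoly, map_sub, map_mul, MvPolynomial.eval_C,
    map_prod, map_pow, MvPolynomial.eval_X, hpow, hz, mul_pow, Finset.prod_mul_distrib]
  rw [show ∀ p q r s : ℂ, p * (q * r) - q * (p * s) = (p * q) * (r - s) by intros; ring,
    mul_eq_zero, or_iff_right (mul_ne_zero (h0 _) (h0 _)), sub_eq_zero, eq_comm]

end Toric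

/-! ### Geometric series over words -/

section Words

variable {ι : Type}

/-- Splitting off the first letter turns the sum into a product of two sums; absolute summability is
carried along in the induction to justify this. -/
theorem hasSum_vector_prod {𝕜 : Type*} [RCLike 𝕜] {a : ι → 𝕜} (ha : Summable fun i => ‖a i‖)
    (k : ℕ) :
    HasSum (fun v : List.Vector ι k => (v.toList.map a).prod) ((∑' i, a i) ^ k) ∧
      Summable fun v : List.Vector ι k => ‖(v.toList.map a).prod‖ := by
  induction k with
  | zero =>
    have : Unique (List.Vector ι 0) := ⟨⟨.nil⟩, fun v => v.eq_nil⟩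
    refine ⟨?_, Summable.of_finite⟩
    simp
  | succ k ih =>
    let e : List.Vector ι (k + 1) ≃ ι × List.Vector ι k :=
      { toFun := fun v => (v.head, v.tail)
        invFun := fun p => p.1 ::ᵥ p.2
        left_inv := fun v => v.cons_head_tail
        right_inv := fun p => by simp }
    have hf : ∀ p : ι × List.Vector ι k, ((e.symm p).toList.map a).prod =
        a p.1 * (p.2.toList.map a).prod := fun p => by
      simp [e]
    have hs := ha.mul_norm ih.2
    have h1 := ha.of_norm.hasSum.mul ih.1 hs.of_norm
    rw [pow_succ']
    refine ⟨e.symm.hasSum_iff.1 (h1.congr_fun fun p => hf p),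
      e.symm.summable_iff.1 (hs.congr fun p => congrArg norm (hf p).symm)⟩

theorem summable_norm_list_prod {𝕜 : Type*} [RCLike 𝕜] {a : ι → 𝕜}
    (ha : Summable fun i => ‖a i‖) (h1 : ∑' i, ‖a i‖ < 1) :
    Summable fun l : List ι => ‖(l.map a).prod‖ := by
  rw [← (Equiv.sigmaFiberEquiv (List.length : List ι → ℕ)).summable_iff]
  refine (summable_sigma_of_nonneg fun _ => norm_nonneg _).2
    ⟨fun k => (hasSum_vector_prod ha k).2, ?_⟩
  refine (summable_geometric_of_lt_one (tsum_nonneg fun i => norm_nonneg (a i)) h1).congr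
    fun k => ?_
  refine ((hasSum_vector_prod (a := fun i => ‖a i‖) (by simpa using ha) k).1.tsum_eq).symm.trans ?_
  refine tsum_congr fun v => ?_
  change _ = ‖(v.toList.map a).prod‖
  rw [List.norm_prod, List.map_map]
  rfl

/-- Summing the products along all words over the alphabet `ι` is a geometric series. -/
theorem hasSum_list_prod {𝕜 : Type*} [RCLike 𝕜] {a : ι → 𝕜}
    (ha : Summable fun i => ‖a i‖) (h1 : ∑' i, ‖a i‖ < 1) :
    HasSum (fun l : List ι => (l.map a).prod) (1 - ∑' i, a i)⁻¹ := by
  have hs := (summable_norm_list_prod ha h1).of_norm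
  have h2 := ((Equiv.sigmaFiberEquiv (List.length : List ι → ℕ)).hasSum_iff.2 hs.hasSum).sigma
    fun k => (hasSum_vector_prod ha k).1
  have h3 : ‖∑' i, a i‖ < 1 := (norm_tsum_le_tsum_norm ha).trans_lt h1
  exact h2.unique (hasSum_geometric_of_norm_lt_one h3) ▸ hs.hasSum

end Words

/-! ### Points of the ball as vectors in the full Fock space -/

section FeatureMap

variable {ι : Type}

theorem hasSum_norm_sq_coord (z : HilbertCd ι) : HasSum (fun i => ‖z i‖ ^ 2) (‖z‖ ^ 2) := by
  simpa using lp.hasSum_norm (p := 2) (by norm_num) z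

theorem memℓp_feature (z : unitBall ι) :
    Memℓp (fun l : List ι => (l.map fun i => star ((z : HilbertCd ι) i)).prod) 2 := by
  have hz : ‖(z : HilbertCd ι)‖ < 1 := mem_ball_zero_iff.mp z.2
  have h := hasSum_norm_sq_coord (z : HilbertCd ι)
  refine memℓp_gen ?_
  -- The squared norms are word products of `‖z i‖ ^ 2`, whose sum over the letters is `‖z‖ ^ 2 <
  -- 1`.
  refine (summable_norm_list_prod (a := fun i => ‖(z : HilbertCd ι) i‖ ^ 2)
    (by simpa using h.summable) ?_).congr fun l => ?_
  · simp only [norm_pow, norm_norm, h.tsum_eq]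
    nlinarith [norm_nonneg (z : HilbertCd ι)]
  · simp only [ENNReal.toReal_ofNat, Real.rpow_ofNat]
    rw [List.norm_prod, List.norm_prod, List.map_map, List.map_map,
      ← Multiset.prod_coe, ← Multiset.map_coe, ← Multiset.prod_coe, ← Multiset.map_coe,
      ← Multiset.prod_map_pow]
    simp

/-- The image of a point of the ball in the full Fock space. -/
def feature (z : unitBall ι) : lp (fun _ : List ι => ℂ) 2 := ⟨_, memℓp_feature z⟩

theorem feature_apply (z : unitBall ι) (l : List ι) :
    feature z l = (l.map fun i => star ((z : HilbertCd ι) i)).prod := rfl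

theorem star_feature_apply (z : unitBall ι) (l : List ι) :
    star (feature z l) = (l.map fun i => (z : HilbertCd ι) i).prod := by
  rw [feature_apply]
  induction l with
  | nil => simp
  | cons i l ih => simp only [List.map_cons, List.prod_cons, star_mul', star_star, ih]

/-- The Drury–Arveson kernel is the geometric series over words in the letters `z i * star (w i)`.
The conjugates in `feature` make the pairing of `feature z` with a coefficient vector a power series
in `z`. -/
theorem inner_feature (z w : unitBall ι) :
    inner ℂ (feature z) (feature w) = dAScalar ι z w := by
  have hz : ‖(z : HilbertCd ι)‖ < 1 := mem_ball_zero_iff.mp z.2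
  have hw : ‖(w : HilbertCd ι)‖ < 1 := mem_ball_zero_iff.mp w.2
  have h1 := hasSum_norm_sq_coord (z : HilbertCd ι)
  have h2 := hasSum_norm_sq_coord (w : HilbertCd ι)
  set a : ι → ℂ := fun i => inner ℂ ((w : HilbertCd ι) i) ((z : HilbertCd ι) i) with ha
  have hle : ∀ i, ‖a i‖ ≤ (‖(z : HilbertCd ι) i‖ ^ 2 + ‖(w : HilbertCd ι) i‖ ^ 2) / 2 := fun i => by
    have := norm_inner_le_norm (𝕜 := ℂ) ((w : HilbertCd ι) i) ((z : HilbertCd ι) i)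
    nlinarith [sq_nonneg (‖(z : HilbertCd ι) i‖ - ‖(w : HilbertCd ι) i‖)]
  have hs := (h1.add h2).div_const 2
  have hsa : Summable fun i => ‖a i‖ := .of_nonneg_of_le (fun _ => norm_nonneg _) hle hs.summable
  have hlt : ∑' i, ‖a i‖ < 1 := by
    refine (hasSum_le hle hsa.hasSum hs).trans_lt ?_
    nlinarith [norm_nonneg (z : HilbertCd ι), norm_nonneg (w : HilbertCd ι)]
  rw [dAScalar, lp.inner_eq_tsum, lp.inner_eq_tsum, one_div, ← (hasSum_list_prod hsa hlt).tsum_eq]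
  refine tsum_congr fun l => ?_
  rw [RCLike.inner_apply, starRingEnd_apply, star_feature_apply, feature_apply,
    ← List.prod_map_mul]
  simp [ha, mul_comm]

end FeatureMap

/-! ### The Drury–Arveson space as power series over words -/

section FockRepresentation

variable {ι : Type}

/-- The kernel functions of the Drury-Arveson space. -/
def dAKerFun (z : unitBall ι) : DruryArveson ι := RKHS.kerFun (DruryArveson ι) z (1 : ℂ)

theorem inner_dAKerFun (z : unitBall ι) (f : DruryArveson ι) : inner ℂ (dAKerFun z) f = f z := by
  rw [dAKerFun, RKHS.kerFun_inner]
  simp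

theorem inner_dAKerFun_dAKerFun (z w : unitBall ι) :
    inner ℂ (dAKerFun z) (dAKerFun w) = dAScalar ι z w := by
  rw [inner_dAKerFun, dAKerFun, RKHS.kerFun_apply, RKHS.OfKernel.kernel_ofKernel]
  simp [dAKernel]

theorem denseRange_linearCombination_dAKerFun :
    DenseRange (Finsupp.linearCombination ℂ (dAKerFun (ι := ι))) := by
  have h := RKHS.kerFun_dense (DruryArveson ι)
  rw [← Submodule.dense_iff_topologicalClosure_eq_top] at h
  refine h.mono ?_
  change _ ⊆ ((LinearMap.range (Finsupp.linearCombination ℂ (dAKerFun (ι := ι))) :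
    Submodule ℂ (DruryArveson ι)) : Set (DruryArveson ι))
  rw [SetLike.coe_subset_coe, Submodule.span_le]
  rintro _ ⟨x, v, rfl⟩
  refine ⟨Finsupp.single x v, ?_⟩
  rw [Finsupp.linearCombination_single, dAKerFun, ← map_smul, smul_eq_mul, mul_one]

/-- The Drury-Arveson space embeds isometrically into the full Fock space. -/
theorem exists_linearIsometry_feature :
    ∃ T : DruryArveson ι →ₗᵢ[ℂ] lp (fun _ : List ι => ℂ) 2, ∀ z, T (dAKerFun z) = feature z := by
  let e := Finsupp.linearCombination ℂ (dAKerFun (ι := ι))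
  let f := Finsupp.linearCombination ℂ (feature (ι := ι))
  -- Kernel functions and features have the same Gram matrix, so matching linear combinations have
  -- equal norms and the map extends from a dense subspace.
  have hnorm : ∀ a, ‖f a‖ = ‖e a‖ := fun a => by
    have : inner ℂ (f a) (f a) = inner ℂ (e a) (e a) := by
      simp only [f, e, Finsupp.linearCombination_apply, Finsupp.sum, sum_inner, inner_sum,
        inner_smul_left, inner_smul_right, inner_feature, inner_dAKerFun_dAKerFun]
    rw [inner_self_eq_norm_sq_to_K, inner_self_eq_norm_sq_to_K] at this
    exact (sq_eq_sq₀ (norm_nonneg _) (norm_nonneg _)).1 (by exact_mod_cast this)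
  have hd : DenseRange e := denseRange_linearCombination_dAKerFun
  have hext : ∀ a, f.extendOfNorm e (e a) = f a :=
    LinearMap.extendOfNorm_eq hd ⟨1, fun a => by rw [one_mul, hnorm]⟩
  refine ⟨⟨(f.extendOfNorm e).toLinearMap, fun x => ?_⟩, fun z => ?_⟩
  · refine hd.induction_on (p := fun x => ‖f.extendOfNorm e x‖ = ‖x‖) x
      (isClosed_eq (by fun_prop) (by fun_prop)) fun a => ?_
    rw [hext, hnorm]
  · have := hext (Finsupp.single z 1)
    simpa [e, f] using this

theorem hasSum_inner_feature (z : unitBall ι) (c : lp (fun _ : List ι => ℂ) 2) :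
    HasSum (fun l => c l * (l.map fun i => (z : HilbertCd ι) i).prod) (inner ℂ (feature z) c) := by
  refine (lp.hasSum_inner (feature z) c).congr_fun fun l => ?_
  rw [RCLike.inner_apply, starRingEnd_apply, star_feature_apply]

/-- Functions in the Drury-Arveson space are noncommutative power series with square summable
coefficients. -/
theorem exists_hasSum_apply (g : DruryArveson ι) : ∃ c : lp (fun _ : List ι => ℂ) 2,
    ∀ z : unitBall ι,
      HasSum (fun l => c l * (l.map fun i => (z : HilbertCd ι) i).prod) (g z) := by
  obtain ⟨T, hT⟩ := exists_linearIsometry_feature (ι := ι)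
  refine ⟨T g, fun z => ?_⟩
  rw [← inner_dAKerFun, ← T.inner_map_map, hT]
  exact hasSum_inner_feature z _

/-- The adjoint of the isometry into Fock space sends any coefficient vector to the function with
that expansion. -/
theorem exists_druryArveson_hasSum (c : lp (fun _ : List ι => ℂ) 2) : ∃ g : DruryArveson ι,
    ∀ z : unitBall ι,
      HasSum (fun l => c l * (l.map fun i => (z : HilbertCd ι) i).prod) (g z) := by
  obtain ⟨T, hT⟩ := exists_linearIsometry_feature (ι := ι)
  refine ⟨T.toContinuousLinearMap.adjoint c, fun z => ?_⟩
  rw [← inner_dAKerFun, ContinuousLinearMap.adjoint_inner_right,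
    LinearIsometry.coe_toContinuousLinearMap, hT]
  exact hasSum_inner_feature z _

end FockRepresentation

/-! ### Multipliers -/

section Multipliers

variable {ι : Type} {g h : unitBall ι → ℂ}

theorem IsDAMultiplier.const (c : ℂ) : IsDAMultiplier fun _ : unitBall ι => c :=
  fun f => ⟨c • f, fun z => by simp⟩

theorem IsDAMultiplier.add (hg : IsDAMultiplier g) (hh : IsDAMultiplier h) :
    IsDAMultiplier fun z => g z + h z := fun f => by
  obtain ⟨p, hp⟩ := hg f
  obtain ⟨q, hq⟩ := hh f
  exact ⟨p + q, fun z => by simp [hp, hq, add_mul]⟩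

theorem IsDAMultiplier.mul (hg : IsDAMultiplier g) (hh : IsDAMultiplier h) :
    IsDAMultiplier fun z => g z * h z := fun f => by
  obtain ⟨q, hq⟩ := hh f
  obtain ⟨p, hp⟩ := hg q
  exact ⟨p, fun z => by simp [hp, hq, mul_assoc]⟩

/-- Multiplication by a coordinate prefixes the letter `i` to every word, which only relocates the
coefficients and so preserves square summability. -/
theorem isDAMultiplier_coord (i : ι) :
    IsDAMultiplier fun z : unitBall ι => (z : HilbertCd ι) i := fun f => by
  obtain ⟨c, hc⟩ := exists_hasSum_apply f
  have hinj : Function.Injective (List.cons i) := List.cons_injective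
  have hext : ∀ t, Function.extend (List.cons i) (c : List ι → ℂ) 0 (i :: t) = c t :=
    fun t => hinj.extend_apply _ _ t
  have hext' : ∀ l, l ∉ Set.range (List.cons i) →
      Function.extend (List.cons i) (c : List ι → ℂ) 0 l = 0 :=
    fun l hl => Function.extend_apply' _ _ _ hl
  have hmem : Memℓp (E := fun _ : List ι => ℂ)
      (Function.extend (List.cons i) (c : List ι → ℂ) 0) 2 := by
    refine memℓp_gen ?_
    rw [← hinj.summable_iff fun l hl => by simp [hext' l hl]]
    simp only [Function.comp_def, hext]
    exact (lp.memℓp c).summable (by norm_num)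
  obtain ⟨q, hq⟩ := exists_druryArveson_hasSum (⟨_, hmem⟩ : lp (fun _ : List ι => ℂ) 2)
  refine ⟨q, fun z => (hq z).unique ?_⟩
  refine (hinj.hasSum_iff fun l hl => ?_).1 (((hc z).mul_left _).congr_fun fun t => ?_)
  · change Function.extend (List.cons i) (c : List ι → ℂ) 0 l * _ = 0
    rw [hext' l hl, zero_mul]
  · change Function.extend (List.cons i) (c : List ι → ℂ) 0 (i :: t) * _ = _
    rw [hext, List.map_cons, List.prod_cons, mul_left_comm]

theorem isDAMultiplier_eval (q : MvPolynomial ι ℂ) :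
    IsDAMultiplier fun z : unitBall ι => MvPolynomial.eval (fun i => (z : HilbertCd ι) i) q := by
  induction q using MvPolynomial.induction_on with
  | C a => simpa using IsDAMultiplier.const a
  | add p q hp hq => simpa using hp.add hq
  | mul_X p i hp => simpa using hp.mul (isDAMultiplier_coord i)

/-- Multipliers belong to the Drury-Arveson space, as the constants do. -/
theorem IsDAMultiplier.exists_hasSum (hg : IsDAMultiplier g) :
    ∃ c : lp (fun _ : List ι => ℂ) 2, ∀ z : unitBall ι,
      HasSum (fun l => c l * (l.map fun i => (z : HilbertCd ι) i).prod) (g z) := by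
  classical
  -- The coefficient vector concentrated at the empty word gives the constant function `1`.
  obtain ⟨one, hone⟩ := exists_druryArveson_hasSum (lp.single 2 ([] : List ι) (1 : ℂ))
  obtain ⟨f, hf⟩ := hg one
  obtain ⟨c, hc⟩ := exists_hasSum_apply f
  refine ⟨c, fun z => ?_⟩
  have h1 : one z = 1 := (hone z).unique <| by
    refine (hasSum_ite_eq ([] : List ι) (1 : ℂ)).congr_fun fun l => ?_
    by_cases hl : l = [] <;> simp [hl, lp.single_apply]
  have := hc z
  rwa [hf, h1, mul_one] at this

end Multipliers

/-! ### Dirichlet series over words and the variety -/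

section DirichletWords

variable {ι : Type} {b : ι → ℝ} {n : ι → ℕ}

theorem list_prod_dirichletCoord (s : ℂ) (l : List ι) :
    (l.map (dirichletCoord b n s)).prod =
      (l.map fun j => (√(b j) : ℂ)).prod * ((l.map n).prod : ℂ) ^ (-s) := by
  induction l with
  | nil => simp
  | cons j l ih =>
    simp only [List.map_cons, List.prod_cons, ih, Nat.cast_mul, dirichletCoord,
      Complex.natCast_mul_natCast_cpow]
    ring

/-- If a Dirichlet series indexed by words vanishes on the right half-plane, then its
coefficients sum to zero along the words with a given product. -/
theorem tsum_fiber_eq_zero {a : List ι → ℂ} (hn : ∀ j, n j ≠ 0)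
    (h : ∀ s : ℂ, 0 < s.re → HasSum (fun l => a l * ((l.map n).prod : ℂ) ^ (-s)) 0) (m : ℕ) :
    ∑' l : (fun l : List ι => (l.map n).prod) ⁻¹' {m}, a l = 0 := by
  have hN : ∀ l : List ι, (l.map n).prod ≠ 0 := fun l h0 => by
    obtain ⟨j, -, hj⟩ := List.mem_map.1 (List.prod_eq_zero_iff.1 h0)
    exact hn j hj
  set A : ℕ → ℂ := fun m => ∑' l : (fun l : List ι => (l.map n).prod) ⁻¹' {m}, a l
  change A m = 0
  have hA0 : A 0 = 0 := by
    have : IsEmpty ((fun l : List ι => (l.map n).prod) ⁻¹' {0}) := ⟨fun l => hN l l.2⟩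
    exact tsum_empty
  have hsum : ∀ s : ℂ, 0 < s.re → HasSum (LSeries.term A s) 0 := fun s hs => by
    refine ((h s hs).tsum_fiberwise fun l : List ι => (l.map n).prod).congr_fun fun k => ?_
    rcases eq_or_ne k 0 with rfl | hk
    · have : IsEmpty ((fun l : List ι => (l.map n).prod) ⁻¹' {0}) := ⟨fun l => hN l l.2⟩
      rw [LSeries.term_zero, tsum_empty]
    · rw [LSeries.term_of_ne_zero hk, div_eq_mul_inv, ← Complex.cpow_neg, ← tsum_mul_right]
      exact tsum_congr fun l => by
        have hl : ((l : List ι).map n).prod = k := l.2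
        rw [hl]
  -- Convergence at one point suffices to exclude the exceptional case of the uniqueness theorem for
  -- Dirichlet series.
  have habs : LSeries.abscissaOfAbsConv A ≠ ⊤ := by
    have h1 : LSeriesSummable A 1 := (hsum 1 (by simp)).summable
    exact (h1.abscissaOfAbsConv_le.trans_lt (EReal.coe_lt_top _)).ne
  have hL : (fun x : ℝ => LSeries A x) =ᶠ[Filter.atTop] 0 := by
    filter_upwards [Filter.eventually_gt_atTop 0] with x hx
    exact (hsum x (by simpa using hx)).tsum_eq
  rcases eq_or_ne m 0 with rfl | hm
  · exact hA0
  · exact (LSeries_eventually_eq_zero_iff'.1 hL).resolve_right habs m hm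

/-- A multiplier that vanishes on the range of `f_{b,n}` vanishes at every point of the ball whose
rescaling `w_j = z_j / √b_j` respects the multiplicative relations between the `n_j`. -/
theorem IsDAMultiplier.apply_eq_zero (hP : PropertyP b n) {g : unitBall ι → ℂ}
    (hg : IsDAMultiplier g) (hg0 : ∀ s, g (hP.toBall s) = 0) {z : unitBall ι} {w : ι → ℂ}
    (hz : ∀ j, (z : HilbertCd ι) j = (√(b j) : ℂ) * w j)
    (hw : ∀ l l' : List ι, (l.map n).prod = (l'.map n).prod →
      (l.map w).prod = (l'.map w).prod) :
    g z = 0 := by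
  obtain ⟨c, hc⟩ := hg.exists_hasSum
  set a : List ι → ℂ := fun l => c l * (l.map fun j => (√(b j) : ℂ)).prod
  have hA := tsum_fiber_eq_zero (a := a) (n := n) (fun j => by have := hP.two_le j; omega)
    fun s hs => by
      have h1 := hc (hP.toBall ⟨s, hs⟩)
      rw [hg0] at h1
      refine h1.congr_fun fun l => ?_
      change _ = c l * (l.map (dirichletCoord b n s)).prod
      rw [list_prod_dirichletCoord, mul_assoc]
  have h2 : HasSum (fun l => a l * (l.map w).prod) (g z) := by
    refine (hc z).congr_fun fun l => ?_
    simp only [hz, List.prod_map_mul, a, mul_assoc]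
  have h3 := h2.tsum_fiberwise fun l : List ι => (l.map n).prod
  refine h3.unique (hasSum_zero.congr_fun fun m => ?_)
  -- Along the words with product `m`, the product of `w` is constant and factors out of a sum
  -- already known to vanish.
  by_cases hm : ∃ l₀ : List ι, (l₀.map n).prod = m
  · obtain ⟨l₀, hl₀⟩ := hm
    calc ∑' l : (fun l : List ι => (l.map n).prod) ⁻¹' {m}, a l * ((l : List ι).map w).prod
        = ∑' l : (fun l : List ι => (l.map n).prod) ⁻¹' {m}, a l * (l₀.map w).prod :=
          tsum_congr fun l => by rw [hw l l₀ (Eq.trans l.2 hl₀.symm)]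
      _ = 0 := by rw [tsum_mul_right, hA m, zero_mul]
  · have : IsEmpty ((fun l : List ι => (l.map n).prod) ⁻¹' {m}) := ⟨fun l => hm ⟨l, l.2⟩⟩
    exact tsum_empty

/-- The coordinates of `f_{b,n}` satisfy the binomial relations. -/
theorem PropertyP.toBall_mem_polyZeroSet_binomialPoly (hP : PropertyP b n) {J : Set ι} {J₁ J₂ : Finset ι}
    {β : ι →₀ ℕ} (hr : IsRepresentation n J J₁ J₂ β) (s : {s : ℂ // 0 < s.re}) :
    (hP.toBall s : HilbertCd ι) ∈ polyZeroSet (binomialPoly b J₁ J₂ β) := by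
  refine (mem_polyZeroSet_binomialPoly_iff hP.pos (w := fun j => (n j : ℂ) ^ (-(s : ℂ)))
    fun j => rfl).2 ?_
  have key : ∀ T : Finset ι, ∏ i ∈ T, ((n i : ℂ) ^ (-(s : ℂ))) ^ β i =
      ((∏ i ∈ T, n i ^ β i : ℕ) : ℂ) ^ (-(s : ℂ)) := fun T => by
    classical
    induction T using Finset.induction_on with
    | empty => simp
    | insert i T hi ih =>
      rw [Finset.prod_insert hi, Finset.prod_insert hi, ih, Nat.cast_mul,
        Complex.natCast_mul_natCast_cpow]
      congr 1
      induction β i with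
      | zero => simp
      | succ k ihk => rw [pow_succ, pow_succ, ihk, Nat.cast_mul, Complex.natCast_mul_natCast_cpow]
  rw [key, key, hr.prod_eq]

theorem multiplierVariety_eq (hP : PropertyP b n) (J₁ J₂ : Set ι → Finset ι)
    (β : Set ι → ι →₀ ℕ)
    (hr : ∀ J ∈ minimalDependentSets n, IsRepresentation n J (J₁ J) (J₂ J) (β J)) :
    multiplierVariety hP = unitBall ι ∩
      ⋂ J ∈ minimalDependentSets n, polyZeroSet (binomialPoly b (J₁ J) (J₂ J) (β J)) := by
  ext z
  simp only [Set.mem_inter_iff, Set.mem_iInter]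
  constructor
  · rintro ⟨hz, h⟩
    exact ⟨hz, fun J hJ => h _ (isDAMultiplier_eval _) fun s =>
      hP.toBall_mem_polyZeroSet_binomialPoly (hr J hJ) s⟩
  · rintro ⟨hz, h⟩
    refine ⟨hz, fun g hg hg0 => ?_⟩
    -- The rescaling is legitimate because each `b j` is positive.
    have hw : ∀ j, z j = (√(b j) : ℂ) * (z j / (√(b j) : ℂ)) := fun j =>
      (mul_div_cancel₀ _ (Complex.ofReal_ne_zero.2 (Real.sqrt_pos.2 (hP.pos j)).ne')).symm
    exact hg.apply_eq_zero hP hg0 hw fun l l' hl =>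
      list_prod_eq_of_representations (fun j => by have := hP.two_le j; omega)
        (fun J hJ => ⟨_, _, _, hr J hJ,
          (mem_polyZeroSet_binomialPoly_iff hP.pos hw).1 (h J hJ)⟩) hl

end DirichletWords

end

theorem theorem4p6 (d : ℕ∞) (hd : 2 ≤ d) (b : TupleIdx d → ℝ) (n : TupleIdx d → ℕ)
    (hP : PropertyP b n)
    (hdep : ¬ LinearIndependent ℚ (fun j => Real.log (n j))) :
    -- every minimal dependent set has a unique partition and a unique coprime tuple
    (∀ J ∈ minimalDependentSets n, ∃ (J₁ J₂ : Finset (TupleIdx d)) (β : TupleIdx d →₀ ℕ),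
      IsRepresentation n J J₁ J₂ β ∧
      ∀ (I₁ I₂ : Finset (TupleIdx d)) (γ : TupleIdx d →₀ ℕ), IsRepresentation n J I₁ I₂ γ →
        γ = β ∧ (I₁ = J₁ ∧ I₂ = J₂ ∨ I₁ = J₂ ∧ I₂ = J₁)) ∧
    -- the variety is cut out of the ball by the associated binomials, whichever part of each
    -- partition is called the first
    ∀ (J₁ J₂ : Set (TupleIdx d) → Finset (TupleIdx d)) (β : Set (TupleIdx d) → TupleIdx d →₀ ℕ),
      (∀ J ∈ minimalDependentSets n, IsRepresentation n J (J₁ J) (J₂ J) (β J)) →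
      multiplierVariety hP =
        unitBall (TupleIdx d) ∩
          ⋂ J ∈ minimalDependentSets n, polyZeroSet (binomialPoly b (J₁ J) (J₂ J) (β J)) := by
  have hn : ∀ j, n j ≠ 0 := fun j => by have := hP.two_le j; omega
  refine ⟨fun J hJ => ?_, fun J₁ J₂ β hr => multiplierVariety_eq hP J₁ J₂ β hr⟩
  obtain ⟨J₁, J₂, β, hr⟩ := exists_isRepresentation hP.two_le hJ
  exact ⟨J₁, J₂, β, hr, fun I₁ I₂ γ h => hr.unique hn hJ h⟩
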